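/- Let $R=\bigoplus_{n\ge 0}R^n$ be a graded-commutative Noetherian ring which is generated over $R^0$ by $R^d$, where $d\ge 2$ is an even integer. Let $\mathsf T$ be an $R$-linear triangulated category with shift $\Sigma$, that is, a triangulated category together with a homomorphism of graded rings from $R$ to the graded center of $\mathsf T$, whose degree $n$ component consists of the natural transformations $\eta:\mathrm{id}_{\mathsf T}\to\Sigma^n$ with $\eta\Sigma=(-1)^n\Sigma\eta$. For objects $X,Y$ of $\mathsf T$ the group $\operatorname{Hom}^*_{\mathsf T}(X,Y)=\bigoplus_{n\in\mathbb Z}\operatorname{Hom}_{\mathsf T}(X,\Sigma^nY)$ is a graded $R$-module; write $\lambda^n(X,Y)$ for the length of the $R^0$-module $\operatorname{Hom}_{\mathsf T}(X,\Sigma^nY)$. Fix $X$ and $Y$ such that $\lambda^n(X,Y)<\infty$ for all $n\in\mathbb Z$ and such that the $R$-module $\bigoplus_{n\ge n_0}\operatorname{Hom}_{\mathsf T}(X,\Sigma^nY)$ is Noetherian for some $n_0\in\mathbb Z$. Then for $0\le i\le d-1$ there is a polynomial $g_i\in\mathbb Q[t]$ with $g_i(n)=\lambda^{dn+i}(X,Y)$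 for all $n\gg0$, and one sets $\operatorname{cx}(X,Y)=1+\max_i\deg g_i$, where $\deg 0=-1$. Put $h(n)=\sum_{i=0}^{d-1}(-1)^{n+i}\lambda^{n+i}(X,Y)$ and $\Delta f(n)=f(n+d)-f(n)$. For $s\ge\operatorname{cx}(X,Y)\ge1$, let $e^s(X,Y)$ be the constant value of $\Delta^{s-1}h(n)$ for $n\gg0$; if $\operatorname{cx}(X,Y)=0$ and $\lambda^n(X,Y)=0$ for $n\ll0$, let $e^0(X,Y)=\sum_{n\in\mathbb Z}(-1)^n\lambda^n(X,Y)$. Theorem. Let $s=\operatorname{cx}(X,Y)$ and assume that $e^s(X,Y)$ is defined and $e^s(X,Y)=0$. Then there is an integer $m_0$ with the following property: if $\lambda^n(X,Y)=0$ for $d/2$ consecutive even values of $n\ge m_0$, or for $d/2$ consecutive odd values of $n\ge m_0$, then $\lambda^n(X,Y)=0$ for all $n\ge m_0$. -/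

import Mathlib

open CategoryTheory DirectSum Polynomial Filter

universe v u w

noncomputable section

namespace LinearTriangulated

section Center

variable (C : Type u) [Category.{v} C] [Preadditive C] [HasShift C ℤ]
  [∀ n : ℤ, (shiftFunctor C n).Additive]

/-- The degree `n` component of the graded center of `(C, Σ)`: the natural transformations
`η : 𝟭 ⟶ Σⁿ` with `ηΣ = (-1)ⁿ Ση` (the functors `ΣⁿΣ` and `ΣΣⁿ` being identified by the
structure isomorphism of the shift). -/
def gradedCenter (n : ℤ) : AddSubgroup (𝟭 C ⟶ shiftFunctor C n) where
  carrier := {η | ∀ X : C, η.app (X⟦(1 : ℤ)⟧) =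
    n.negOnePow • ((η.app X)⟦(1 : ℤ)⟧' ≫ (shiftComm X n 1).hom)}
  zero_mem' := by
    intro X
    simp
  add_mem' := by
    intro η θ hη hθ X
    have h1 := hη X
    have h2 := hθ X
    simp only [NatTrans.app_add] at *
    rw [h1, h2, Functor.map_add, Preadditive.add_comp, smul_add]
  neg_mem' := by
    intro η hη X
    have h1 := hη X
    simp only [NatTrans.app_neg] at *
    rw [h1, Functor.map_neg, Preadditive.neg_comp, smul_neg]

end Center

variable {R : Type w} [Ring R] (𝒜 : ℕ → AddSubgroup R) [GradedRing 𝒜]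
variable (C : Type u) [Category.{v} C] [Preadditive C] [HasShift C ℤ]
  [∀ n : ℤ, (shiftFunctor C n).Additive]

/-- A central action of the graded ring `R = ⨁ 𝒜 n` on `C`: a homomorphism of graded rings from
`R` to the graded center of `C`. The product of `η` and `θ` in the graded center (of degrees
`k` and `l`) is the composite `𝟭 ⟶ Σˡ ⟶ Σᵏ⁺ˡ` of `θ` and `Σˡη`. -/
structure CentralAction where
  /-- the homogeneous components of the ring homomorphism -/
  toCenter (k : ℕ) : 𝒜 k →+ gradedCenter C (k : ℤ)
  app_one (X : C) :
    ((toCenter 0 ⟨1, SetLike.GradedOne.one_mem⟩ :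
      gradedCenter C ((0 : ℕ) : ℤ)) : 𝟭 C ⟶ shiftFunctor C ((0 : ℕ) : ℤ)).app X =
      ShiftedHom.mk₀ ((0 : ℕ) : ℤ) Nat.cast_zero (𝟙 X)
  app_mul {k l : ℕ} (r : 𝒜 k) (s : 𝒜 l) (X : C) :
    ((toCenter (k + l) ⟨(r : R) * (s : R), SetLike.GradedMul.mul_mem r.2 s.2⟩ :
      gradedCenter C ((k + l : ℕ) : ℤ)) : 𝟭 C ⟶ shiftFunctor C ((k + l : ℕ) : ℤ)).app X =
      ShiftedHom.comp (X := X) (Y := X) (Z := X) ((toCenter l s).1.app X) ((toCenter k r).1.app X)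
        (Nat.cast_add k l).symm

variable {𝒜 C}

namespace CentralAction

variable (φ : CentralAction 𝒜 C)

/-- The homomorphism `φ_X : R ⟶ Hom*(X, X)` in degree `k`. -/
def act {k : ℕ} (r : 𝒜 k) (X : C) : ShiftedHom X X (k : ℤ) := (φ.toCenter k r).1.app X

lemma act_add {k : ℕ} (r s : 𝒜 k) (X : C) : φ.act (r + s) X = φ.act r X + φ.act s X := by
  simp [act]

lemma act_zero {k : ℕ} (X : C) : φ.act (0 : 𝒜 k) X = 0 := by
  simp [act]

/-- `Hom(X, ΣⁿY)`, to be regarded as a module over `R⁰`. -/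
@[nolint unusedArguments]
def HomDeg (_φ : CentralAction 𝒜 C) (X Y : C) (n : ℤ) : Type v := ShiftedHom X Y n

instance (X Y : C) (n : ℤ) : AddCommGroup (φ.HomDeg X Y n) :=
  inferInstanceAs (AddCommGroup (X ⟶ Y⟦n⟧))

/-- The action of `r` of degree `k` from `Hom(X, ΣⁿY)` to `Hom(X, Σᵏ⁺ⁿY)`: composition with
`Σⁿφ_Y(r)`. -/
def smulDeg {X Y : C} {k : ℕ} {n m : ℤ} (h : (k : ℤ) + n = m) (r : 𝒜 k) (f : φ.HomDeg X Y n) :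
    φ.HomDeg X Y m :=
  ShiftedHom.comp (X := X) (Y := Y) (Z := Y) f (φ.act r Y) h

lemma smulDeg_add {X Y : C} {k : ℕ} {n m : ℤ} (h : (k : ℤ) + n = m) (r : 𝒜 k)
    (f g : φ.HomDeg X Y n) : φ.smulDeg h r (f + g) = φ.smulDeg h r f + φ.smulDeg h r g :=
  ShiftedHom.add_comp (X := X) (Y := Y) (Z := Y) f g (φ.act r Y) h

lemma smulDeg_zero {X Y : C} {k : ℕ} {n m : ℤ} (h : (k : ℤ) + n = m) (r : 𝒜 k) :
    φ.smulDeg h r (0 : φ.HomDeg X Y n) = 0 :=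
  ShiftedHom.zero_comp (Y := Y) (Z := Y) X n (φ.act r Y) h

lemma add_smulDeg {X Y : C} {k : ℕ} {n m : ℤ} (h : (k : ℤ) + n = m) (r s : 𝒜 k)
    (f : φ.HomDeg X Y n) : φ.smulDeg h (r + s) f = φ.smulDeg h r f + φ.smulDeg h s f := by
  rw [smulDeg, act_add]
  exact ShiftedHom.comp_add (X := X) (Y := Y) (Z := Y) f _ _ h

lemma zero_smulDeg {X Y : C} {k : ℕ} {n m : ℤ} (h : (k : ℤ) + n = m)
    (f : φ.HomDeg X Y n) : φ.smulDeg h (0 : 𝒜 k) f = 0 := by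
  rw [smulDeg, act_zero]
  exact ShiftedHom.comp_zero (X := X) (Y := Y) Y f h

lemma one_smulDeg {X Y : C} {n : ℤ} (h : ((0 : ℕ) : ℤ) + n = n) (f : φ.HomDeg X Y n) :
    φ.smulDeg h (⟨1, SetLike.GradedOne.one_mem⟩ : 𝒜 0) f = f := by
  have := φ.app_one Y
  rw [smulDeg, act, this]
  exact ShiftedHom.comp_mk₀_id (X := X) (Y := Y) f _ _

lemma mul_smulDeg {X Y : C} {k l : ℕ} {n m p : ℤ} (h₁ : (l : ℤ) + n = m) (h₂ : (k : ℤ) + m = p)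
    (h : ((k + l : ℕ) : ℤ) + n = p) (r : 𝒜 k) (s : 𝒜 l) (f : φ.HomDeg X Y n) :
    φ.smulDeg h (⟨(r : R) * (s : R), SetLike.GradedMul.mul_mem r.2 s.2⟩ : 𝒜 (k + l)) f =
      φ.smulDeg h₂ r (φ.smulDeg h₁ s f) := by
  have := φ.app_mul r s Y
  rw [smulDeg, act, this]
  exact (ShiftedHom.comp_assoc (X := X) (Y := Y) (Z := Y) (T := Y) f (φ.act s Y) (φ.act r Y)
    h₁ (Nat.cast_add k l).symm (by omega)).symm

/-- `Hom(X, ΣⁿY)` is a module over `R⁰`. -/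
instance (X Y : C) (n : ℤ) : Module (𝒜 0) (φ.HomDeg X Y n) where
  smul r f := φ.smulDeg (by simp) r f
  one_smul f := φ.one_smulDeg (by simp) f
  mul_smul r s f := φ.mul_smulDeg (by simp) (by simp) (by simp) r s f
  smul_zero r := φ.smulDeg_zero (by simp) r
  smul_add r f g := φ.smulDeg_add (by simp) r f g
  add_smul r s f := φ.add_smulDeg (by simp) r s f
  zero_smul f := φ.zero_smulDeg (by simp) f

/-- The graded module `Hom*(X, Y) = ⨁ₙ Hom(X, ΣⁿY)`. -/
def HomStar (X Y : C) : Type v := ⨁ n : ℤ, φ.HomDeg X Y n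

instance (X Y : C) : AddCommGroup (φ.HomStar X Y) :=
  inferInstanceAs (AddCommGroup (⨁ n : ℤ, φ.HomDeg X Y n))

/-- Degrees add: an element of degree `k` sends degree `n` to degree `k + n`. -/
local instance degreeVAdd : VAdd ℕ ℤ := ⟨fun k n => (k : ℤ) + n⟩

lemma mk_smulDeg_eq {X Y : C} {k k' : ℕ} {n m m' : ℤ} (h : (k : ℤ) + n = m)
    (h' : (k' : ℤ) + n = m') (hk : k = k') (r : 𝒜 k) (r' : 𝒜 k') (hr : (r : R) = r')
    (f : φ.HomDeg X Y n) :
    (⟨m, φ.smulDeg h r f⟩ : GradedMonoid (φ.HomDeg X Y)) = ⟨m', φ.smulDeg h' r' f⟩ := by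
  subst hk
  obtain rfl : m = m' := by omega
  obtain rfl : r = r' := Subtype.ext hr
  rfl

local instance homGmodule (X Y : C) :
    DirectSum.Gmodule (fun k => 𝒜 k) (fun n => φ.HomDeg X Y n) where
  smul {k n} r f := φ.smulDeg (m := k +ᵥ n) rfl r f
  one_smul := by
    rintro ⟨n, f⟩
    refine Eq.trans ?_ (congrArg (fun g => (⟨n, g⟩ : GradedMonoid (φ.HomDeg X Y)))
      (φ.one_smulDeg (by simp) f))
    exact φ.mk_smulDeg_eq _ _ rfl _ _ rfl f
  mul_smul := by
    rintro ⟨k, r⟩ ⟨l, s⟩ ⟨n, f⟩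
    refine Eq.trans ?_ (congrArg (fun g => (⟨k +ᵥ (l +ᵥ n), g⟩ : GradedMonoid (φ.HomDeg X Y)))
      (φ.mul_smulDeg (m := l +ᵥ n) (p := k +ᵥ (l +ᵥ n)) rfl rfl
        (by show ((k + l : ℕ) : ℤ) + n = (k : ℤ) + ((l : ℤ) + n); push_cast; ring) r s f))
    exact φ.mk_smulDeg_eq _ _ rfl _ _ rfl f
  smul_add r f g := φ.smulDeg_add rfl r f g
  smul_zero r := φ.smulDeg_zero rfl r
  add_smul r s f := φ.add_smulDeg rfl r s f
  zero_smul f := φ.zero_smulDeg rfl f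

/-- `Hom*(X, Y)` is a module over `R`. -/
instance homStarModule (X Y : C) : Module R (φ.HomStar X Y) :=
  letI : Module (⨁ k, 𝒜 k) (φ.HomStar X Y) :=
    inferInstanceAs (Module (⨁ k, 𝒜 k) (⨁ n : ℤ, φ.HomDeg X Y n))
  Module.compHom _ (decomposeRingEquiv 𝒜 : R →+* ⨁ k, 𝒜 k)

/-- A homogeneous element of `Hom*(X, Y)`. -/
def ofDeg (X Y : C) (n : ℤ) : φ.HomDeg X Y n →+ φ.HomStar X Y :=
  DirectSum.of (fun n : ℤ => φ.HomDeg X Y n) n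

/-- The component in degree `n` of an element of `Hom*(X, Y)`. -/
def component (X Y : C) (n : ℤ) : φ.HomStar X Y →+ φ.HomDeg X Y n where
  toFun f := (show ⨁ n : ℤ, φ.HomDeg X Y n from f) n
  map_zero' := rfl
  map_add' _ _ := rfl

lemma smul_ofDeg {X Y : C} {k : ℕ} {n : ℤ} (r : 𝒜 k) (f : φ.HomDeg X Y n) :
    (r : R) • φ.ofDeg X Y n f = φ.ofDeg X Y (k + n) (φ.smulDeg rfl r f) := by
  change (DirectSum.Gmodule.smulAddMonoidHom (fun k => 𝒜 k) (fun n => φ.HomDeg X Y n))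
    (decompose 𝒜 (r : R)) (DirectSum.of (fun n : ℤ => φ.HomDeg X Y n) n f) = _
  rw [decompose_coe, DirectSum.Gmodule.smulAddMonoidHom_apply_of_of]
  rfl

lemma component_smul_eq_zero {X Y : C} {n₀ : ℤ} (r : R) (f : φ.HomStar X Y)
    (hf : ∀ n < n₀, φ.component X Y n f = 0) (n : ℤ) (hn : n < n₀) :
    φ.component X Y n (r • f) = 0 := by
  classical
  have hf' : f = ∑ m ∈ DFinsupp.support (show Π₀ n : ℤ, φ.HomDeg X Y n from f),
      φ.ofDeg X Y m (φ.component X Y m f) :=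
    (DirectSum.sum_support_of (show ⨁ n : ℤ, φ.HomDeg X Y n from f)).symm
  induction r using DirectSum.Decomposition.inductionOn 𝒜 with
  | zero => simp
  | add r s hr hs => rw [add_smul, map_add, hr, hs, add_zero]
  | @homogeneous k r =>
    rw [hf', Finset.smul_sum, map_sum]
    refine Finset.sum_eq_zero fun m _ => ?_
    by_cases hm : m < n₀
    · rw [hf m hm, map_zero, smul_zero, map_zero]
    · rw [smul_ofDeg]
      exact DirectSum.of_eq_of_ne _ _ _ (by omega)

/-- The `R`-submodule `Hom^{≥ n₀}(X, Y) = ⨁_{n ≥ n₀} Hom(X, ΣⁿY)` of `Hom*(X, Y)`. -/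
def homGE (X Y : C) (n₀ : ℤ) : Submodule R (φ.HomStar X Y) where
  carrier := {f | ∀ n < n₀, φ.component X Y n f = 0}
  zero_mem' := fun n _ => map_zero _
  add_mem' := fun {f g} hf hg n hn => by rw [map_add, hf n hn, hg n hn, add_zero]
  smul_mem' := fun r f hf => φ.component_smul_eq_zero r f hf

/-- `Hom*(X, Y)` is eventually Noetherian over `R`. -/
def EventuallyNoetherian (X Y : C) : Prop := ∃ n₀ : ℤ, IsNoetherian R (φ.homGE X Y n₀)

/-- `λⁿ(X, Y)`, the length of `Hom(X, ΣⁿY)` over `R⁰`. -/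
def lam (X Y : C) (n : ℤ) : ℕ∞ := Module.length (𝒜 0) (φ.HomDeg X Y n)

/-- `Hom*(X, Y)` is eventually Noetherian over `R` and of finite length over `R⁰` in each
degree. -/
def IsNoethFL (X Y : C) : Prop := φ.EventuallyNoetherian X Y ∧ ∀ n : ℤ, φ.lam X Y n ≠ ⊤

/-- The index `d` generalized Herbrand difference (meant for pairs with all `λⁿ(X, Y)` finite). -/
def herbrand (d : ℕ) (X Y : C) (n : ℤ) : ℤ :=
  ∑ i ∈ Finset.range d, ((n + i).negOnePow : ℤ) * ((φ.lam X Y (n + i)).toNat : ℤ)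

/-- `g` is the Hilbert polynomial of `n ↦ λ^{dn+i}(X, Y)`: they agree for `n ≫ 0`. -/
def IsHilbertPoly (d : ℕ) (X Y : C) (i : ℕ) (g : ℚ[X]) : Prop :=
  ∀ᶠ n : ℤ in atTop, g.eval (n : ℚ) = ((φ.lam X Y (d * n + i)).toNat : ℚ)

open Classical in
/-- The Hilbert polynomial `g_i` of the pair `(X, Y)`. -/
def hilbertPoly (d : ℕ) (X Y : C) (i : ℕ) : ℚ[X] :=
  if h : ∃ g, φ.IsHilbertPoly d X Y i g then h.choose else 0

/-- The complexity `1 + max {deg g_i | 0 ≤ i < d}`, where the zero polynomial has degree `-1`. -/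
def cx (d : ℕ) (X Y : C) : ℕ :=
  (Finset.range d).sup fun i =>
    if φ.hilbertPoly d X Y i = 0 then 0 else (φ.hilbertPoly d X Y i).natDegree + 1

end CentralAction

/-- The difference operator of index `d`. -/
def diffOp (d : ℕ) (f : ℤ → ℤ) (n : ℤ) : ℤ := f (n + d) - f n

namespace CentralAction

variable (φ : CentralAction 𝒜 C)

/-- The `s`-multiplicity `eˢ(X, Y)` is defined and equal to `e`: either `s ≥ cx(X, Y) ≥ 1` and
`e` is the value of `Δ^{s-1} h(X, Y)(n)` for all `n ≫ 0`, or `s = cx(X, Y) = 0`, one has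
`λⁿ(X, Y) = 0` for `n ≪ 0`, and `e` is the (finite) alternating sum of the `λⁿ(X, Y)`. -/
def HasMultiplicity (d : ℕ) (X Y : C) (s : ℕ) (e : ℤ) : Prop :=
  (1 ≤ φ.cx d X Y ∧ φ.cx d X Y ≤ s ∧
    ∀ᶠ n : ℤ in atTop, (diffOp d)^[s - 1] (φ.herbrand d X Y) n = e) ∨
  (φ.cx d X Y = 0 ∧ s = 0 ∧ (∀ᶠ n : ℤ in atBot, φ.lam X Y n = 0) ∧
    ∑ᶠ n : ℤ, (n.negOnePow : ℤ) * ((φ.lam X Y n).toNat : ℤ) = e)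

end CentralAction

end LinearTriangulated

end

/-! For large m write λ^{dm+i} = g_i(m). As d is even, d/2 consecutive degrees of one parity meet
every residue class mod d of that parity. If such runs of zeros occur arbitrarily far out in parity
p, each g_i with i ≡ p mod 2 therefore has infinitely many roots and is zero
(`hilbertPoly_eq_zero_of_runs`). Then h(dm) is, up to one global sign, the sum of the remaining g_i.
When s ≥ 1 their coefficients in degree s-1 are nonnegative and one is positive, so nothing cancels
and Δ^{s-1}h does not vanish at large multiples of d (`not_eventually_diffOp_herbrand_eq_zero`),
against e^s = 0. So for s ≥ 1 the runs of zeros stop in both parities, and m₀ is taken past them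
all, where the premise fails. For s = 0 every g_i is zero and λ^n itself vanishes for large n.

The g_i come from a Hilbert-Serre theorem (`exists_polynomial_length`), applied to the degrees in
one class mod d, the operators being finitely many generators of R^d over R^0. Noetherianity enters
as the ascending chain condition on families of submodules stable under the operators, so no
polynomial ring over R^0 is needed. -/

noncomputable section

namespace LinearTriangulated

/-! ### Hilbert-Serre theorem for commuting operators of degree one -/

section HilbertSerre

/-- Bernoulli polynomials satisfy B_{n+1}(x+1) - B_{n+1}(x) = (n+1)x^n, which settles monomials. -/
lemma exists_polynomial_sub_eq (p : ℚ[X]) :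
    ∃ q : ℚ[X], ∀ x : ℚ, q.eval (x + 1) - q.eval x = p.eval x := by
  induction p using Polynomial.induction_on' with
  | add p q hp hq =>
    obtain ⟨p', hp'⟩ := hp
    obtain ⟨q', hq'⟩ := hq
    refine ⟨p' + q', fun x => ?_⟩
    rw [eval_add, eval_add, eval_add, ← hp', ← hq']
    ring
  | monomial n a =>
    refine ⟨C (a / (n + 1)) * Polynomial.bernoulli (n + 1), fun x => ?_⟩
    have h := Polynomial.bernoulli_eval_one_add (n + 1) x
    have hn : (n : ℚ) + 1 ≠ 0 := by positivity
    rw [add_comm x 1, eval_mul, eval_mul, h]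
    simp only [eval_C, eval_monomial, Nat.add_sub_cancel, Nat.cast_add, Nat.cast_one]
    field_simp
    ring

lemma exists_polynomial_of_sub {f : ℕ → ℚ} {p : ℚ[X]}
    (h : ∀ᶠ n : ℕ in atTop, f (n + 1) - f n = p.eval (n : ℚ)) :
    ∃ q : ℚ[X], ∀ᶠ n : ℕ in atTop, q.eval (n : ℚ) = f n := by
  obtain ⟨q, hq⟩ := exists_polynomial_sub_eq p
  obtain ⟨N, hN⟩ := eventually_atTop.1 h
  refine ⟨q + C (f N - q.eval (N : ℚ)), eventually_atTop.2 ⟨N, fun n hn => ?_⟩⟩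
  induction n, hn using Nat.le_induction with
  | base => simp
  | succ n hn ih =>
    have h1 := hN n hn
    have h2 := hq n
    simp only [eval_add, eval_C, Nat.cast_add, Nat.cast_one] at ih ⊢
    linarith

variable {A : Type*} [Ring A]

/-- The families of submodules `P n ≤ M n` which are stable under the operators `x j`. -/
abbrev StableFamily {ι : Type*} {M : ℕ → Type*} [∀ n, AddCommGroup (M n)] [∀ n, Module A (M n)]
    (x : ι → ∀ n, M n →ₗ[A] M (n + 1)) :=
  {P : ∀ n, Submodule A (M n) // ∀ j n, P n ≤ (P (n + 1)).comap (x j n)}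

section

variable {ι κ : Type*} {M : ℕ → Type*} [∀ n, AddCommGroup (M n)] [∀ n, Module A (M n)]
  (x : ι → ∀ n, M n →ₗ[A] M (n + 1))

/-- If there are no operators and stable families satisfy the ascending chain condition, then
`M n` vanishes eventually. -/
lemma StableFamily.eventually_subsingleton [IsEmpty ι] [WellFoundedGT (StableFamily x)] :
    ∀ᶠ n in atTop, Subsingleton (M n) := by
  -- The truncations, full up to degree k and zero above, form an ascending chain; with no operators
  -- they are trivially stable.
  let F : ℕ →o StableFamily x :=
    ⟨fun k => ⟨fun n => if n ≤ k then ⊤ else ⊥, fun j => isEmptyElim j⟩, fun k l hkl n => by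
      dsimp only
      split_ifs <;> first | omega | simp⟩
  obtain ⟨N, hN⟩ := WellFoundedGT.monotone_chain_condition F
  refine eventually_atTop.2 ⟨N + 1, fun n hn => ?_⟩
  have h : (if n ≤ N then ⊤ else ⊥ : Submodule A (M n)) = if n ≤ n then ⊤ else ⊥ :=
    congrFun (congrArg Subtype.val (hN n (by omega))) n
  rw [if_neg (by omega), if_pos le_rfl] at h
  exact (Submodule.subsingleton_iff A).1 (subsingleton_of_bot_eq_top h)

variable (y : ∀ n, M n →ₗ[A] M (n + 1))
  (hy : ∀ j n m, x j (n + 1) (y n m) = y (n + 1) (x j n m))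

/-- The operators induced on the kernel of `y`. -/
def kerOperator (j : ι) (n : ℕ) : LinearMap.ker (y n) →ₗ[A] LinearMap.ker (y (n + 1)) :=
  (x j n).restrict fun m hm => by
    rw [LinearMap.mem_ker] at hm ⊢
    rw [← hy, hm, map_zero]

/-- The operators induced on the cokernel of `y`. -/
def cokerOperator (j : ι) (n : ℕ) :
    (M (n + 1) ⧸ LinearMap.range (y n)) →ₗ[A] (M (n + 1 + 1) ⧸ LinearMap.range (y (n + 1))) :=
  Submodule.mapQ _ _ (x j (n + 1)) (by
    rintro _ ⟨m, rfl⟩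
    exact ⟨x j n m, (hy j n m).symm⟩)

-- In the induction z is the full list of operators and x is that list without its last member y.
variable (z : κ → ∀ n, M n →ₗ[A] M (n + 1)) [WellFoundedGT (StableFamily z)]
  (hz : ∀ k, z k = y ∨ ∃ j, z k = x j)

include hz

/-- Since y kills its kernel, a family in the kernel stable under x is stable under all of z; this
embeds the stable families in those of M. -/
lemma wellFoundedGT_kerOperator : WellFoundedGT (StableFamily (kerOperator x y hy)) := by
  let F : StableFamily (kerOperator x y hy) → StableFamily z := fun P =>
    ⟨fun n => (P.1 n).map (LinearMap.ker (y n)).subtype, by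
      rintro k n _ ⟨m, hm, rfl⟩
      obtain h | ⟨j, h⟩ := hz k
      · rw [h, Submodule.mem_comap]
        have : y n m = 0 := m.2
        simp [this]
      · rw [h]
        exact ⟨_, P.2 j n hm, rfl⟩⟩
  have hF : Monotone F := fun P Q hPQ n => Submodule.map_mono (hPQ n)
  refine (hF.strictMono_of_injective fun P Q hPQ => ?_).wellFoundedGT
  refine Subtype.ext (funext fun n => ?_)
  exact Submodule.map_injective_of_injective (Submodule.subtype_injective _)
    (congrFun (congrArg Subtype.val hPQ) n)

lemma wellFoundedGT_cokerOperator : WellFoundedGT (StableFamily (cokerOperator x y hy)) := by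
  let F : StableFamily (cokerOperator x y hy) → StableFamily z := fun P =>
    ⟨fun n => match n with
      -- The cokernel in index n is a quotient of M (n + 1), so preimages start in degree 1 and
      -- degree 0 is filled with zero.
      | 0 => ⊥
      | n + 1 => (P.1 n).comap (LinearMap.range (y n)).mkQ, by
      intro k n
      match n with
      | 0 => exact bot_le
      | n + 1 =>
        intro m hm
        obtain h | ⟨j, h⟩ := hz k
        · rw [h]
          show (LinearMap.range (y (n + 1))).mkQ (y (n + 1) m) ∈ P.1 (n + 1)
          have : (LinearMap.range (y (n + 1))).mkQ (y (n + 1) m) = 0 := by simp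
          rw [this]
          exact zero_mem _
        · rw [h]
          exact P.2 j n hm⟩
  have hF : Monotone F := fun P Q hPQ n => by
    match n with
    | 0 => exact le_rfl
    | n + 1 => exact Submodule.comap_mono (hPQ n)
  refine (hF.strictMono_of_injective fun P Q hPQ => ?_).wellFoundedGT
  refine Subtype.ext (funext fun n => ?_)
  exact Submodule.comap_injective_of_surjective (Submodule.mkQ_surjective _)
    (congrFun (congrArg Subtype.val hPQ) (n + 1))

end

lemma length_sub_length_eq {M N : Type*} [AddCommGroup M] [AddCommGroup N] [Module A M]
    [Module A N] (f : M →ₗ[A] N) (hM : Module.length A M ≠ ⊤) (hN : Module.length A N ≠ ⊤) :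
    ((Module.length A N).toNat : ℚ) - (Module.length A M).toNat =
      (Module.length A (N ⧸ LinearMap.range f)).toNat -
        (Module.length A (LinearMap.ker f)).toNat := by
  have h1 := Module.length_eq_add_of_exact (LinearMap.ker f).subtype f.rangeRestrict
    (Submodule.subtype_injective _) f.surjective_rangeRestrict
    (by rw [LinearMap.exact_iff, LinearMap.ker_rangeRestrict, Submodule.range_subtype])
  have h2 := Module.length_eq_add_of_exact (LinearMap.range f).subtype (LinearMap.range f).mkQ
    (Submodule.subtype_injective _) (Submodule.mkQ_surjective _)
    (LinearMap.exact_subtype_mkQ _)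
  rw [h1] at hM ⊢
  rw [h2] at hN ⊢
  rw [Ne, ENat.add_eq_top, not_or] at hM hN
  rw [ENat.toNat_add hM.1 hM.2, ENat.toNat_add hN.1 hN.2]
  push_cast
  ring

/-- The Hilbert-Serre theorem: the lengths of the components of a graded module, Noetherian under
finitely many commuting operators of degree one, are eventually given by a polynomial. -/
theorem exists_polynomial_length (r : ℕ) {M : ℕ → Type v} [∀ n, AddCommGroup (M n)]
    [∀ n, Module A (M n)] (x : Fin r → ∀ n, M n →ₗ[A] M (n + 1))
    (hx : ∀ i j n m, x i (n + 1) (x j n m) = x j (n + 1) (x i n m))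
    (hM : ∀ n, Module.length A (M n) ≠ ⊤) [WellFoundedGT (StableFamily x)] :
    ∃ p : ℚ[X], ∀ᶠ n : ℕ in atTop, p.eval (n : ℚ) = ((Module.length A (M n)).toNat : ℚ) := by
  induction r generalizing M with
  | zero =>
    refine ⟨0, (StableFamily.eventually_subsingleton x).mono fun n hn => ?_⟩
    simp [Module.length_eq_zero]
  | succ r ih =>
    let x' : Fin r → ∀ n, M n →ₗ[A] M (n + 1) := fun j => x j.castSucc
    let y := x (Fin.last r)
    have hy : ∀ j n m, x' j (n + 1) (y n m) = y (n + 1) (x' j n m) := fun j n m => hx _ _ _ _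
    have hz : ∀ k, x k = y ∨ ∃ j, x k = x' j := by
      intro k
      induction k using Fin.lastCases with
      | last => exact Or.inl rfl
      | cast j => exact Or.inr ⟨j, rfl⟩
    have := wellFoundedGT_kerOperator x' y hy x hz
    have := wellFoundedGT_cokerOperator x' y hy x hz
    obtain ⟨p, hp⟩ := ih (kerOperator x' y hy)
      (fun i j n m => Subtype.ext (hx _ _ _ _))
      (fun n h => hM n (top_unique (h ▸ Module.length_le_of_injective
        (LinearMap.ker (y n)).subtype (Submodule.subtype_injective _))))
    obtain ⟨q, hq⟩ := ih (cokerOperator x' y hy)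
      (fun i j n m => by
        obtain ⟨m, rfl⟩ := Submodule.mkQ_surjective _ m
        exact congrArg (LinearMap.range (y (n + 1 + 1))).mkQ
          (hx i.castSucc j.castSucc (n + 1) m))
      (fun n h => hM (n + 1) (top_unique (h ▸ Module.length_le_of_surjective
        (LinearMap.range (y n)).mkQ (Submodule.mkQ_surjective _))))
    -- The difference of consecutive lengths is the length of the cokernel of y minus that of its
    -- kernel.
    refine exists_polynomial_of_sub (p := q - p) ?_
    filter_upwards [hp, hq] with n hpn hqn
    rw [eval_sub, hpn, hqn]
    exact length_sub_length_eq (y n) (hM n) (hM (n + 1))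

end HilbertSerre

/-! ### Hom*(X, Y) as a graded module and its Hilbert polynomials -/

variable {R : Type w} [Ring R] {𝒜 : ℕ → AddSubgroup R} [GradedRing 𝒜]
variable {C : Type u} [Category.{v} C] [Preadditive C] [HasShift C ℤ]
  [∀ n : ℤ, (shiftFunctor C n).Additive]

/-- In a graded Noetherian ring, each homogeneous component is finitely generated over the
component of degree zero. -/
lemma exists_generators [IsNoetherianRing R] (d : ℕ) :
    ∃ (r : ℕ) (x : Fin r → 𝒜 d), ∀ a ∈ 𝒜 d, ∃ c : Fin r → 𝒜 0, a = ∑ j, (c j : R) * x j := by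
  obtain ⟨s, hs, hspan⟩ := (Submodule.fg_span_iff_fg_span_finset_subset (R := R) (𝒜 d : Set R)).1
    (IsNoetherian.noetherian _)
  let e := s.equivFin
  refine ⟨s.card, fun j => ⟨(e.symm j : R), hs (e.symm j).2⟩, fun a ha => ?_⟩
  have ha' : a ∈ Submodule.span R (s : Set R) := hspan ▸ Submodule.subset_span ha
  obtain ⟨c, -, hc⟩ := Submodule.mem_span_finset.1 ha'
  -- Only the degree 0 parts of the coefficients contribute to the component of degree d.
  refine ⟨fun j => decompose 𝒜 (c (e.symm j)) 0, ?_⟩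
  have h1 : ((decompose 𝒜 a d : 𝒜 d) : R) = a := decompose_of_mem_same 𝒜 ha
  rw [← h1, ← hc, decompose_sum, DFinsupp.finsetSum_apply, AddSubgroup.val_finsetSum,
    ← Finset.sum_coe_sort s, ← e.symm.sum_comp]
  refine Finset.sum_congr rfl fun j _ => ?_
  have := coe_decompose_mul_add_of_right_mem 𝒜 (i := 0) (j := d)
    (a := c (e.symm j)) (b := (e.symm j : R)) (hs (e.symm j).2)
  rwa [zero_add] at this

namespace CentralAction

variable (φ : CentralAction 𝒜 C) {X Y : C}

lemma component_ofDeg_self (n : ℤ) (f : φ.HomDeg X Y n) :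
    φ.component X Y n (φ.ofDeg X Y n f) = f :=
  DirectSum.of_eq_same _ _

lemma component_ofDeg_of_ne {n m : ℤ} (h : m ≠ n) (f : φ.HomDeg X Y n) :
    φ.component X Y m (φ.ofDeg X Y n f) = 0 :=
  DirectSum.of_eq_of_ne _ _ _ h

lemma component_smul {k : ℕ} {n m : ℤ} (h : (k : ℤ) + n = m) (r : 𝒜 k) (f : φ.HomStar X Y) :
    φ.component X Y m ((r : R) • f) = φ.smulDeg h r (φ.component X Y n f) := by
  induction f using DirectSum.induction_on with
  | zero =>
    change φ.component X Y m ((r : R) • (0 : φ.HomStar X Y)) =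
      φ.smulDeg h r (φ.component X Y n (0 : φ.HomStar X Y))
    rw [smul_zero, map_zero, map_zero, smulDeg_zero]
  | of l f =>
    change φ.component X Y m ((r : R) • φ.ofDeg X Y l f) =
      φ.smulDeg h r (φ.component X Y n (φ.ofDeg X Y l f))
    rw [smul_ofDeg]
    by_cases hl : l = n
    · subst hl
      subst h
      rw [component_ofDeg_self, component_ofDeg_self]
    · rw [component_ofDeg_of_ne _ (by omega), component_ofDeg_of_ne _ (Ne.symm hl), smulDeg_zero]
  | add f g hf hg =>
    let f' : φ.HomStar X Y := f
    let g' : φ.HomStar X Y := g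
    change φ.component X Y m ((r : R) • (f' + g')) = φ.smulDeg h r (φ.component X Y n (f' + g'))
    rw [smul_add, map_add, map_add, smulDeg_add]
    exact congrArg₂ _ hf hg

lemma smulDeg_congr {k k' : ℕ} {n m : ℤ} (h : (k : ℤ) + n = m) (h' : (k' : ℤ) + n = m)
    {r : 𝒜 k} {r' : 𝒜 k'} (hr : (r : R) = r') (f : φ.HomDeg X Y n) :
    φ.smulDeg h r f = φ.smulDeg h' r' f := by
  obtain rfl : k = k' := by omega
  obtain rfl : r = r' := Subtype.ext hr
  rfl

lemma smulDeg_comm {k l : ℕ} {n m m' p : ℤ} (r : 𝒜 k) (s : 𝒜 l) (hrs : (r : R) * s = s * r)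
    (h₁ : (l : ℤ) + n = m) (h₂ : (k : ℤ) + m = p) (h₃ : (k : ℤ) + n = m') (h₄ : (l : ℤ) + m' = p)
    (f : φ.HomDeg X Y n) :
    φ.smulDeg h₂ r (φ.smulDeg h₁ s f) = φ.smulDeg h₄ s (φ.smulDeg h₃ r f) := by
  rw [← φ.mul_smulDeg h₁ h₂ (by push_cast; omega), ← φ.mul_smulDeg h₃ h₄ (by push_cast; omega)]
  exact φ.smulDeg_congr _ _ hrs f

section Operators

variable {d : ℕ} (h0 : ∀ r ∈ 𝒜 0, ∀ s ∈ 𝒜 d, r * s = s * r)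

/-- Multiplication by an element of degree `d`, on the family `n ↦ Hom(X, Σ^{dn+c}Y)`. -/
def operator (X Y : C) (c : ℤ) (r : 𝒜 d) (n : ℕ) :
    φ.HomDeg X Y (d * (n : ℕ) + c) →ₗ[𝒜 0] φ.HomDeg X Y (d * (n + 1 : ℕ) + c) where
  toFun := φ.smulDeg (by push_cast; ring) r
  map_add' := φ.smulDeg_add _ r
  map_smul' a f := φ.smulDeg_comm r a (h0 _ a.2 _ r.2).symm _ _ _ _ f

variable {r : ℕ} {x : Fin r → 𝒜 d}
  (hx : ∀ a ∈ 𝒜 d, ∃ c : Fin r → 𝒜 0, a = ∑ j, (c j : R) * x j)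

include hx

/-- The x j generate R^d over R^0 and each P n is an R^0-module, so stability under the x j extends
to all of R^d. -/
lemma smulDeg_mem {c : ℤ} (P : StableFamily fun j => φ.operator h0 X Y c (x j)) (a : 𝒜 d) (n : ℕ)
    (h : (d : ℤ) + (d * (n : ℕ) + c) = d * (n + 1 : ℕ) + c)
    {f : φ.HomDeg X Y (d * (n : ℕ) + c)} (hf : f ∈ P.1 n) : φ.smulDeg h a f ∈ P.1 (n + 1) := by
  obtain ⟨b, hb⟩ := hx a a.2
  let F : 𝒜 d →+ φ.HomDeg X Y (d * (n + 1 : ℕ) + c) :=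
    ⟨⟨fun a => φ.smulDeg h a f, φ.zero_smulDeg h f⟩, fun a a' => φ.add_smulDeg h a a' f⟩
  have hmem (j : Fin r) : (b j : R) * x j ∈ 𝒜 d := by
    have := SetLike.GradedMul.mul_mem (b j).2 (x j).2
    rwa [zero_add] at this
  have ha : a = ∑ j, (⟨(b j : R) * x j, hmem j⟩ : 𝒜 d) :=
    Subtype.ext (by rw [AddSubgroup.val_finsetSum]; exact hb)
  change F a ∈ _
  rw [ha, map_sum]
  refine sum_mem fun j _ => ?_
  have h1 : F ⟨(b j : R) * x j, hmem j⟩ = b j • φ.operator h0 X Y c (x j) n f :=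
    (φ.smulDeg_congr (k' := 0 + d) h (by push_cast; ring)
      (r' := ⟨(b j : R) * x j, SetLike.GradedMul.mul_mem (b j).2 (x j).2⟩) rfl f).trans
      (φ.mul_smulDeg h (by simp) (by push_cast; ring) (b j) (x j) f)
  rw [h1]
  exact Submodule.smul_mem _ _ (P.2 j n hf)

variable (hgen : Subring.closure ((𝒜 0 : Set R) ∪ (𝒜 d : Set R)) = ⊤)

include hgen

/-- A stable family of submodules of `n ↦ Hom(X, Σ^{dn+c}Y)` gives an `R`-submodule. -/
def submoduleOfStableFamily {n₀ c : ℤ} (hc : c < n₀ + d)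
    (P : StableFamily fun j => φ.operator h0 X Y c (x j)) : Submodule R (φ.homGE X Y n₀) where
  carrier := {f | ∀ n : ℕ, φ.component X Y (d * n + c) f.1 ∈ P.1 n}
  zero_mem' n := by
    rw [Submodule.coe_zero, map_zero]
    exact zero_mem _
  add_mem' hf hg n := by
    rw [Submodule.coe_add, map_add]
    exact add_mem (hf n) (hg n)
  smul_mem' a := by
    have ha : a ∈ Subring.closure ((𝒜 0 : Set R) ∪ (𝒜 d : Set R)) := hgen ▸ Subring.mem_top a
    induction ha using Subring.closure_induction with
    | mem a ha =>
      intro f hf n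
      rw [Submodule.coe_smul]
      obtain ha | ha := ha
      · rw [φ.component_smul (n := d * n + c) (by simp) ⟨a, ha⟩]
        exact Submodule.smul_mem _ (⟨a, ha⟩ : 𝒜 0) (hf n)
      · match n with
        | 0 =>
          -- Degree c is reached only from degree c - d < n₀, where f has no component.
          rw [φ.component_smul (n := c - d) (by push_cast; ring) ⟨a, ha⟩, f.2 _ (by omega),
            smulDeg_zero]
          exact zero_mem _
        | n + 1 =>
          rw [φ.component_smul (n := d * n + c) (by push_cast; ring) ⟨a, ha⟩]
          exact φ.smulDeg_mem h0 hx P ⟨a, ha⟩ n _ (hf n)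
    | zero =>
      intro f hf n
      rw [zero_smul, Submodule.coe_zero, map_zero]
      exact zero_mem _
    | one =>
      intro f hf
      rwa [one_smul]
    | add a b _ _ ha hb =>
      intro f hf n
      rw [add_smul, Submodule.coe_add, map_add]
      exact add_mem (ha hf n) (hb hf n)
    | neg a _ ha =>
      intro f hf n
      rw [neg_smul, Submodule.coe_neg, map_neg]
      exact neg_mem (ha hf n)
    | mul a b _ _ ha hb =>
      intro f hf
      rw [mul_smul]
      exact ha (hb hf)

/-- The passage from stable families to submodules reflects inclusion, as testing on homogeneous
elements shows; n₀ ≤ c puts these elements in `homGE`. -/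
lemma wellFoundedGT_stableFamily (hd : d ≠ 0) {n₀ c : ℤ} (hc₀ : n₀ ≤ c) (hc : c < n₀ + d)
    [IsNoetherian R (φ.homGE X Y n₀)] :
    WellFoundedGT (StableFamily fun j => φ.operator h0 X Y c (x j)) := by
  let F := φ.submoduleOfStableFamily (X := X) (Y := Y) h0 hx hgen hc
  have hF : Monotone F := fun P Q hPQ f hf n => hPQ n (hf n)
  have key : ∀ P Q, F P ≤ F Q → P ≤ Q := by
    intro P Q hPQ n m hm
    have hge : (0 : ℤ) ≤ d * n := by positivity
    let f : φ.homGE X Y n₀ := ⟨φ.ofDeg X Y (d * n + c) m, fun l hl =>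
      φ.component_ofDeg_of_ne (by omega) m⟩
    have hf : f ∈ F P := by
      intro l
      by_cases hl : l = n
      · subst hl
        exact (φ.component_ofDeg_self _ m).symm ▸ hm
      · have : (d : ℤ) * l + c ≠ d * n + c := by
          simpa [hd] using hl
        exact (φ.component_ofDeg_of_ne this m).symm ▸ zero_mem _
    have := hPQ hf n
    rwa [φ.component_ofDeg_self] at this
  exact (hF.strictMono_of_injective fun P Q h =>
    le_antisymm (key P Q h.le) (key Q P h.ge)).wellFoundedGT

end Operators

/-- The existence of the Hilbert polynomials of a pair `(X, Y)`. -/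
theorem exists_isHilbertPoly [IsNoetherianRing R] {d : ℕ} (hd : d ≠ 0)
    (h0 : ∀ r ∈ 𝒜 0, ∀ s ∈ 𝒜 d, r * s = s * r) (h1 : ∀ r ∈ 𝒜 d, ∀ s ∈ 𝒜 d, r * s = s * r)
    (hgen : Subring.closure ((𝒜 0 : Set R) ∪ (𝒜 d : Set R)) = ⊤)
    (hXY : φ.IsNoethFL X Y) (i : ℕ) : ∃ g, φ.IsHilbertPoly d X Y i g := by
  obtain ⟨⟨n₀, hn₀⟩, hfin⟩ := hXY
  obtain ⟨r, x, hx⟩ := exists_generators (𝒜 := 𝒜) d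
  have hd' : (0 : ℤ) < d := by positivity
  -- c is the representative of i mod d in the window [n₀, n₀ + d), and t the resulting shift of the
  -- polynomial's variable.
  let c : ℤ := n₀ + (i - n₀) % d
  let t : ℤ := (i - n₀) / d
  have hct : (i : ℤ) = d * t + c := by
    have := Int.mul_ediv_add_emod (i - n₀) d
    simp only [c, t]
    linarith
  have := φ.wellFoundedGT_stableFamily (X := X) (Y := Y) h0 hx hgen hd (n₀ := n₀) (c := c)
    (by have := Int.emod_nonneg (i - n₀) hd'.ne'; omega)
    (by have := Int.emod_lt_of_pos (i - n₀) hd'; omega)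
  obtain ⟨p, hp⟩ := exists_polynomial_length r (fun j => φ.operator h0 X Y c (x j))
    (fun j k n f => φ.smulDeg_comm (x j) (x k) (h1 _ (x j).2 _ (x k).2) _ _ _ _ f)
    (fun n => hfin _)
  obtain ⟨N, hN⟩ := eventually_atTop.1 hp
  refine ⟨p.comp (Polynomial.X + Polynomial.C (t : ℚ)),
    eventually_atTop.2 ⟨N - t, fun n hn => ?_⟩⟩
  obtain ⟨k, hk⟩ := Int.eq_ofNat_of_zero_le (show 0 ≤ n + t by omega)
  have h2 := hN k (by omega)
  have h3 : (d : ℤ) * n + i = d * k + c := by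
    rw [hct, ← hk]
    ring
  have h4 : (k : ℚ) = n + t := by exact_mod_cast hk.symm
  rw [h3, eval_comp, eval_add, eval_X, eval_C, ← h4, h2]
  rfl

end CentralAction

/-! ### Polynomials at large integers and finite differences -/

lemma coeff_nonneg_of_eventually_nonneg {g : ℚ[X]} {k : ℕ} (hk : g.natDegree ≤ k)
    (h : ∀ᶠ n : ℤ in atTop, 0 ≤ g.eval (n : ℚ)) : 0 ≤ g.coeff k := by
  obtain hk | rfl := hk.lt_or_eq
  · rw [coeff_eq_zero_of_natDegree_lt hk]
  by_contra! hneg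
  change g.leadingCoeff < 0 at hneg
  obtain hdeg | hdeg := Nat.eq_zero_or_pos g.natDegree
  · rw [eq_C_of_natDegree_eq_zero hdeg] at h hneg
    obtain ⟨n, hn⟩ := h.exists
    rw [leadingCoeff_C] at hneg
    rw [eval_C] at hn
    exact hneg.not_ge hn
  · have h1 := (g.tendsto_atBot_of_leadingCoeff_nonpos (natDegree_pos_iff_degree_pos.1 hdeg)
      hneg.le).comp (tendsto_intCast_atTop_atTop (R := ℚ))
    obtain ⟨n, hn, hn'⟩ := (h.and (h1.eventually_lt_atBot 0)).exists
    exact hn'.not_ge hn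

lemma eq_zero_of_frequently_eval_eq_zero {g : ℚ[X]}
    (h : ∃ᶠ n : ℤ in atTop, g.eval (n : ℚ) = 0) : g = 0 := by
  refine g.eq_zero_of_infinite_isRoot (Set.infinite_of_not_bddAbove ?_)
  rintro ⟨b, hb⟩
  obtain ⟨n, hn, hn'⟩ := (h.and_eventually (eventually_gt_atTop ⌈b⌉)).exists
  exact ((Int.le_ceil b).trans_lt (Int.cast_lt.2 hn')).not_ge (hb hn)

/-- Along multiples of d, the difference of index d becomes the forward difference of step 1. -/
lemma eventually_diffOp_iterate (d k : ℕ) {f : ℤ → ℤ} {F : ℚ → ℚ}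
    (h : ∀ᶠ m : ℤ in atTop, (f (d * m) : ℚ) = F m) :
    ∀ᶠ m : ℤ in atTop, ((diffOp d)^[k] f (d * m) : ℚ) = (fwdDiff 1)^[k] F m := by
  induction k generalizing f F with
  | zero => exact h
  | succ k ih =>
    refine ih ?_
    filter_upwards [h, (tendsto_atTop_add_const_right atTop (1 : ℤ) tendsto_id).eventually h]
      with m h1 h2
    rw [id_eq, mul_add, mul_one] at h2
    rw [diffOp, fwdDiff, Int.cast_sub, h1, h2, Int.cast_add, Int.cast_one]

/-! ### Vanishing of Hilbert polynomials and of the multiplicity -/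

namespace CentralAction

variable (φ : CentralAction 𝒜 C) {X Y : C}

lemma isHilbertPoly_hilbertPoly {d i : ℕ} (h : ∃ g, φ.IsHilbertPoly d X Y i g) :
    φ.IsHilbertPoly d X Y i (φ.hilbertPoly d X Y i) := by
  rw [hilbertPoly, dif_pos h]
  exact h.choose_spec

lemma hilbertPoly_eq_zero_of_runs {d i : ℕ} (hd : 2 ≤ d) (hd_even : Even d)
    (hg : φ.IsHilbertPoly d X Y i (φ.hilbertPoly d X Y i))
    (h : ∀ m₀ : ℤ, ∃ n, m₀ ≤ n ∧ n % 2 = i % 2 ∧ ∀ j < d / 2, φ.lam X Y (n + 2 * j) = 0) :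
    φ.hilbertPoly d X Y i = 0 := by
  refine eq_zero_of_frequently_eval_eq_zero ?_
  have hfreq : ∃ᶠ m : ℤ in atTop, φ.lam X Y (d * m + i) = 0 := by
    refine frequently_atTop.2 fun M => ?_
    obtain ⟨n, hn, hpar, hrun⟩ := h (d * M + i)
    obtain ⟨e, rfl⟩ := hd_even
    -- k is the residue of i - n mod d. It is even and less than d, so n + k is a member of the run
    -- lying in the class of i.
    obtain ⟨k, hk⟩ := Int.eq_ofNat_of_zero_le
      (Int.emod_nonneg ((i : ℤ) - n) (show ((e + e : ℕ) : ℤ) ≠ 0 by omega))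
    have hlt := Int.emod_lt_of_pos ((i : ℤ) - n) (show (0 : ℤ) < (e + e : ℕ) by omega)
    have hdiv := Int.mul_ediv_add_emod ((i : ℤ) - n) (e + e : ℕ)
    set q := ((i : ℤ) - n) / (e + e : ℕ)
    rw [hk] at hlt hdiv
    have hk2 : k % 2 = 0 := by
      have h1 : ((e + e : ℕ) : ℤ) * q = 2 * (e * q) := by push_cast; ring
      rw [h1] at hdiv
      omega
    refine ⟨-q, ?_, ?_⟩
    · have hpos : (0 : ℤ) < (e + e : ℕ) := by omega
      refine le_of_mul_le_mul_left ?_ hpos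
      rw [mul_neg]
      omega
    · have h2 := hrun (k / 2) (by omega)
      have h3 : ((e + e : ℕ) : ℤ) * -q + i = n + 2 * (k / 2 : ℕ) := by
        rw [mul_neg]
        omega
      rw [h3, h2]
  refine (hfreq.and_eventually hg).mono fun m hm => ?_
  rw [hm.2, hm.1]
  simp

lemma eventually_lam_eq_zero {d : ℕ} (hd : d ≠ 0) (hfin : ∀ n : ℤ, φ.lam X Y n ≠ ⊤)
    (hg : ∀ i, φ.IsHilbertPoly d X Y i (φ.hilbertPoly d X Y i)) (hcx : φ.cx d X Y = 0) :
    ∀ᶠ n : ℤ in atTop, φ.lam X Y n = 0 := by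
  have hg0 : ∀ i ∈ Finset.range d, φ.hilbertPoly d X Y i = 0 := by
    intro i hi
    have h := (Finset.le_sup (f := fun i => if φ.hilbertPoly d X Y i = 0 then 0 else
      (φ.hilbertPoly d X Y i).natDegree + 1) hi).trans_eq hcx
    by_contra hne
    simp [hne] at h
  have h1 : ∀ᶠ m : ℤ in atTop, ∀ i ∈ Finset.range d, φ.lam X Y (d * m + i) = 0 := by
    refine (Filter.eventually_all_finset _).2 fun i hi => (hg i).mono fun m hm => ?_
    -- `toNat` also sends ⊤ to 0, so finiteness of the length is needed to conclude.
    rw [hg0 i hi, eval_zero, eq_comm, Nat.cast_eq_zero, ENat.toNat_eq_zero] at hm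
    exact hm.resolve_right (hfin _)
  obtain ⟨N, hN⟩ := eventually_atTop.1 h1
  have hd' : (0 : ℤ) < d := by positivity
  refine eventually_atTop.2 ⟨d * N, fun n hn => ?_⟩
  have h2 := hN (n / d) ((Int.le_ediv_iff_mul_le hd').2 (by linarith)) (n % d).toNat
    (Finset.mem_range.2 (by have := Int.emod_lt_of_pos n hd'; omega))
  rwa [Int.toNat_of_nonneg (Int.emod_nonneg n hd'.ne'), Int.mul_ediv_add_emod] at h2

/-- If the Hilbert polynomials of one parity vanish and the complexity is positive, then the
multiplicity does not vanish. -/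
lemma not_eventually_diffOp_herbrand_eq_zero {d : ℕ} (hd_even : Even d)
    (hg : ∀ i, φ.IsHilbertPoly d X Y i (φ.hilbertPoly d X Y i)) (hcx : 1 ≤ φ.cx d X Y)
    (p : ℕ) (hp : ∀ i, i % 2 = p % 2 → φ.hilbertPoly d X Y i = 0) :
    ¬ ∀ᶠ n : ℤ in atTop, (diffOp d)^[φ.cx d X Y - 1] (φ.herbrand d X Y) n = 0 := by
  intro h
  obtain ⟨k, hk⟩ := Nat.exists_eq_add_of_le' hcx
  rw [hk, Nat.add_sub_cancel] at h
  let g := φ.hilbertPoly d X Y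
  let G := ∑ i ∈ Finset.range d, g i
  -- The common sign of the terms of parity opposite to p, the only ones that survive.
  let ε : ℚ := (-1) ^ (p + 1)
  have hdeg : ∀ i ∈ Finset.range d, (g i).natDegree ≤ k := by
    intro i hi
    have h1 := (Finset.le_sup (f := fun i => if φ.hilbertPoly d X Y i = 0 then 0 else
      (φ.hilbertPoly d X Y i).natDegree + 1) hi).trans_eq hk
    by_cases h0 : φ.hilbertPoly d X Y i = 0
    · simp [g, h0]
    · simpa [h0] using h1
  have hcoeff : ∀ i ∈ Finset.range d, 0 ≤ (g i).coeff k := fun i hi =>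
    coeff_nonneg_of_eventually_nonneg (hdeg i hi) ((hg i).mono fun m hm => by
      rw [hm]
      positivity)
  have hpos : 0 < G.coeff k := by
    have hne : (Finset.range d).Nonempty := by
      rw [Finset.nonempty_iff_ne_empty]
      intro h0
      simp [cx, h0] at hk
    obtain ⟨i, hi, h1⟩ := Finset.exists_mem_eq_sup (Finset.range d) hne
      (fun i => if φ.hilbertPoly d X Y i = 0 then 0 else (φ.hilbertPoly d X Y i).natDegree + 1)
    have h2 := h1.symm.trans hk
    have h0 : φ.hilbertPoly d X Y i ≠ 0 := by
      intro h0
      simp [h0] at h2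
    simp only [h0, if_false, Nat.add_right_cancel_iff] at h2
    rw [finsetSum_coeff]
    refine Finset.sum_pos' hcoeff ⟨i, hi, (hcoeff i hi).lt_of_ne ?_⟩
    rw [← h2]
    exact (leadingCoeff_ne_zero.2 h0).symm
  have hGdeg : G.natDegree = k := natDegree_eq_of_le_of_coeff_ne_zero
    (natDegree_sum_le_of_forall_le _ _ hdeg) hpos.ne'
  have hherbrand : ∀ᶠ m : ℤ in atTop,
      (φ.herbrand d X Y (d * m) : ℚ) = (Polynomial.C ε * G).eval (m : ℚ) := by
    have h1 : ∀ᶠ m : ℤ in atTop, ∀ i ∈ Finset.range d,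
        (g i).eval (m : ℚ) = ((φ.lam X Y (d * m + i)).toNat : ℚ) :=
      (Filter.eventually_all_finset _).2 fun i _ => hg i
    refine h1.mono fun m hm => ?_
    rw [herbrand, eval_mul, eval_C, eval_finsetSum, Finset.mul_sum, Int.cast_sum]
    refine Finset.sum_congr rfl fun i hi => ?_
    rw [hm i hi, Int.cast_mul, Int.cast_natCast]
    by_cases hi2 : i % 2 = p % 2
    · have h2 := hm i hi
      rw [show g i = 0 from hp i hi2, eval_zero] at h2
      rw [← h2, mul_zero, mul_zero]
    · congr 1
      have hdm : Even ((d : ℤ) * m) := ((Int.even_coe_nat d).2 hd_even).mul_right m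
      rw [Int.negOnePow_add, Int.negOnePow_even _ hdm, one_mul]
      obtain hpe | hpo := Nat.even_or_odd p
      · have hio : Odd i := by rw [Nat.odd_iff]; rw [Nat.even_iff] at hpe; omega
        rw [Int.negOnePow_odd _ (by exact_mod_cast hio)]
        simp [ε, pow_succ, hpe.neg_one_pow]
      · have hie : Even i := by rw [Nat.even_iff]; rw [Nat.odd_iff] at hpo; omega
        rw [Int.negOnePow_even _ (by exact_mod_cast hie)]
        simp [ε, pow_succ, hpo.neg_one_pow]
  have hε : ε ≠ 0 := by simp [ε]
  have hne : Polynomial.C ε * G ≠ 0 := by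
    refine mul_ne_zero (C_ne_zero.2 hε) fun h0 => ?_
    simp [h0] at hpos
  have hPdeg : (Polynomial.C ε * G).natDegree = k := by
    rw [natDegree_C_mul hε, hGdeg]
  have h1 := eventually_diffOp_iterate d k (F := (Polynomial.C ε * G).eval) hherbrand
  have hd0 : (0 : ℤ) < d := by
    have : d ≠ 0 := by
      rintro rfl
      simp [cx] at hk
    positivity
  have h2 : ∀ᶠ m : ℤ in atTop, (diffOp d)^[k] (φ.herbrand d X Y) (d * m) = 0 :=
    (tendsto_id.const_mul_atTop' hd0).eventually h
  obtain ⟨m, hm1, hm2⟩ := (h1.and h2).exists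
  -- The k-th difference of a polynomial of degree k is k! times its leading coefficient.
  have h3 := congrFun (Polynomial.fwdDiff_iter_degree_eq_factorial (Polynomial.C ε * G)) (m : ℚ)
  rw [hPdeg, ← hm1, hm2] at h3
  simp [Nat.factorial_ne_zero, hε] at h3
  exact hne (by simp [h3])

end CentralAction

end LinearTriangulated

end

/-! ### The vanishing theorem -/

theorem mainTheorem2 {R : Type w} [Ring R] [IsNoetherianRing R]
    (𝒜 : ℕ → AddSubgroup R) [GradedRing 𝒜]
    (hcomm : ∀ (k l : ℕ) (r s : R), r ∈ 𝒜 k → s ∈ 𝒜 l → r * s = (-1) ^ (k * l) * (s * r))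
    (d : ℕ) (hd : 2 ≤ d) (hd_even : Even d)
    (hgen : Subring.closure ((𝒜 0 : Set R) ∪ (𝒜 d : Set R)) = ⊤)
    {T : Type u} [CategoryTheory.Category.{v} T] [CategoryTheory.Preadditive T]
    [CategoryTheory.Limits.HasZeroObject T] [CategoryTheory.HasShift T ℤ]
    [∀ n : ℤ, (CategoryTheory.shiftFunctor T n).Additive]
    [CategoryTheory.Pretriangulated T] [CategoryTheory.IsTriangulated T]
    (φ : LinearTriangulated.CentralAction 𝒜 T) (X Y : T)
    (hXY : φ.IsNoethFL X Y)
    (he : φ.HasMultiplicity d X Y (φ.cx d X Y) 0) :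
    ∃ m₀ : ℤ,
      ((∃ n : ℤ, m₀ ≤ n ∧ Even n ∧ ∀ j < d / 2, φ.lam X Y (n + 2 * j) = 0) ∨
        (∃ n : ℤ, m₀ ≤ n ∧ Odd n ∧ ∀ j < d / 2, φ.lam X Y (n + 2 * j) = 0)) →
      ∀ n : ℤ, m₀ ≤ n → φ.lam X Y n = 0 := by
  have hg : ∀ i, φ.IsHilbertPoly d X Y i (φ.hilbertPoly d X Y i) := fun i =>
    φ.isHilbertPoly_hilbertPoly (φ.exists_isHilbertPoly (by omega)
      -- The signs (-1)^(0·d) and (-1)^(d·d) are 1 because d is even, so graded commutativity is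
      -- strict here.
      (fun r hr s hs => by simpa using hcomm 0 d r s hr hs)
      (fun r hr s hs => by simpa [(hd_even.mul_right d).neg_one_pow] using hcomm d d r s hr hs)
      hgen hXY i)
  obtain ⟨hcx, -, hmult⟩ | ⟨hcx, -⟩ := he
  · by_contra! hcon
    have key (p : ℕ) : ¬ ∀ m₀ : ℤ, ∃ n, m₀ ≤ n ∧ n % 2 = (p % 2 : ℕ) ∧
        ∀ j < d / 2, φ.lam X Y (n + 2 * j) = 0 := fun hrun =>
      φ.not_eventually_diffOp_herbrand_eq_zero hd_even hg hcx p
        (fun i hi => φ.hilbertPoly_eq_zero_of_runs hd hd_even (hg i) (by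
          rw [← hi] at hrun
          exact_mod_cast hrun)) hmult
    have h0 := key 0
    have h1 := key 1
    push Not at h0 h1
    obtain ⟨m, hm⟩ := h0
    obtain ⟨m', hm'⟩ := h1
    -- Past both bounds there are no runs of zeros of either parity, contradicting the premise at
    -- `max m m'`.
    obtain ⟨⟨n, hn, hpar, hrun⟩ | ⟨n, hn, hpar, hrun⟩, -⟩ := hcon (max m m')
    · obtain ⟨j, hj, hne⟩ := hm n (by omega) (by simpa using Int.even_iff.1 hpar)
      exact hne (hrun j hj)
    · obtain ⟨j, hj, hne⟩ := hm' n (by omega) (by simpa using Int.odd_iff.1 hpar)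
      exact hne (hrun j hj)
  · obtain ⟨m₀, hm₀⟩ := eventually_atTop.1
      (φ.eventually_lam_eq_zero (by omega) hXY.2 hg hcx)
    exact ⟨m₀, fun _ => hm₀⟩
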